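/- Let $d\ge 1$ and let $D\subset\mathbb{R}^d$ be a bounded open set (for instance a bounded convex polyhedral domain with $d\in\{1,2,3\}$). Let $V=H_0^1(D)$ (the closure of $C_c^\infty(D)$ in $H^1(D)$) with the norm $\|v\|_V=\|\nabla v\|_{L^2(D)}$, let $V^*$ be its dual space with the dual norm, and let $U=[-\tfrac12,\tfrac12]^{\mathbb{N}}$. Let $a_0\in L^\infty(D)$ with $0<a_{0,\min}\le a_0\le a_{0,\max}<\infty$ a.e. on $D$, let $\psi_j\in L^\infty(D)$ for $j\ge1$, and put $a(x,y)=a_0(x)+\sum_{j\ge1}y_j\psi_j(x)$ for $y\in U$. Assume that there is $\overline\kappa\in(0,1)$ with $$\Big\|\sum_{j\ge1}\frac{|\psi_j|}{2a_0}\Big\|_{L^\infty(D)}\le\overline\kappa ,$$ and that $b=(b_j)_{j\ge1}$ is a sequence with $0<b_j\le1$ and $$\kappa:=\Big\|\sum_{j\ge1}\frac{|\psi_j|/b_j}{2a_0}\Big\|_{L^\infty(D)}<1 .$$ For a finitely supported multi-index $\nu$ write $|\nu|=\sum_j\nu_j$, $b^\nu=\prod_j b_j^{\nu_j}$, and $$\widetilde\kappa(\nu)=\Big\|\sum_{j\in\operatorname{supp}\nu}\frac{|\psi_j|/b_j}{2a_0}\Big\|_{L^\infty(D)}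 .$$ Let $f\in V^*$. Then for every $y\in U$ there is a unique $u(\cdot,y)\in V$ with $$\int_D a(x,y)\,\nabla u(x,y)\cdot\nabla v(x)\,dx=\langle f,v\rangle_{V^*\times V}\qquad\text{for all }v\in V .$$ Let $\nu$ be a finitely supported multi-index with entries in $\{0,1\}$. Then the mixed partial derivatives $\partial^\omega u(\cdot,y)$ with respect to the parameters $y$, $\omega\le\nu$, exist in $V$ at every $y\in U$ (one-sided where $y_j=\pm\frac12$) and do not depend on the order of differentiation. For every $k\in\{0,1,\dots,|\nu|\}$ and every $y\in U$, $$\sum_{\substack{\omega\le\nu\\|\omega|=k}}b^{-2\omega}\,\|\partial^\omega u(\cdot,y)\|_V^2\le\left(\Big(\frac{2\widetilde\kappa(\nu)}{1-\overline\kappa}\Big)^{k}\frac{\|f\|_{V^*}}{(1-\overline\kappa)\,a_{0,\min}}\right)^2 ,$$ and, for $k=|\nu|$, $$\|\partial^\nu u(\cdot,y)\|_V\le b^\nu\Big(\frac{2\widetilde\kappa(\nu)}{1-\overline\kappa}\Big)^{|\nu|}\frac{\|f\|_{V^*}}{(1-\overline\kappa)\,a_{0,\min}} .$$ -/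

import Mathlib

open MeasureTheory Set Filter Topology
open scoped ENNReal Distributions RealInnerProductSpace

noncomputable section

namespace ParametricDiffusion

/-- A bounded open subset of `ℝ^d`, where `d ≥ 1`. -/
structure BoundedDomain (d : ℕ) extends TopologicalSpace.Opens (EuclideanSpace ℝ (Fin d)) where
  dim_pos : 0 < d
  bounded : Bornology.IsBounded carrier

variable {d : ℕ}

/-- Lebesgue measure on `D`. -/
abbrev BoundedDomain.measure (D : BoundedDomain d) : Measure (EuclideanSpace ℝ (Fin d)) :=
  volume.restrict (D.toOpens : Set (EuclideanSpace ℝ (Fin d)))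

/-- The real Hilbert space `L²(D)`. -/
abbrev L2 (D : BoundedDomain d) : Type := Lp ℝ 2 D.measure

/-- The real Hilbert space `L²(D; ℝ^d)` of square integrable vector fields. -/
abbrev L2Vec (D : BoundedDomain d) : Type := Lp (EuclideanSpace ℝ (Fin d)) 2 D.measure

section TestFunctions

variable (D : BoundedDomain d) (φ : 𝓓(D.toOpens, ℝ))

theorem contDiff_test :
    ContDiff ℝ ((⊤ : ℕ∞) : WithTop ℕ∞) (φ : EuclideanSpace ℝ (Fin d) → ℝ) := φ.contDiff

theorem differentiable_test : Differentiable ℝ (φ : EuclideanSpace ℝ (Fin d) → ℝ) :=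
  (contDiff_test D φ).differentiable (by simp)

theorem continuous_fderiv_test : Continuous (fderiv ℝ (φ : EuclideanSpace ℝ (Fin d) → ℝ)) :=
  (contDiff_test D φ).continuous_fderiv (by simp)

theorem continuous_gradient_test :
    Continuous (gradient (φ : EuclideanSpace ℝ (Fin d) → ℝ)) :=
  (InnerProductSpace.toDual ℝ (EuclideanSpace ℝ (Fin d))).symm.continuous.comp
    (continuous_fderiv_test D φ)

theorem hasCompactSupport_gradient_test :
    HasCompactSupport (gradient (φ : EuclideanSpace ℝ (Fin d) → ℝ)) :=
  (φ.hasCompactSupport.fderiv (𝕜 := ℝ)).comp_left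
    (g := (InnerProductSpace.toDual ℝ (EuclideanSpace ℝ (Fin d))).symm) (map_zero _)

theorem memLp_test : MemLp φ 2 D.measure :=
  (φ.continuous.memLp_of_hasCompactSupport φ.hasCompactSupport).restrict _

theorem memLp_gradient_test :
    MemLp (gradient (φ : EuclideanSpace ℝ (Fin d) → ℝ)) 2 D.measure :=
  ((continuous_gradient_test D φ).memLp_of_hasCompactSupport
    (hasCompactSupport_gradient_test D φ)).restrict _

/-- The linear map `φ ↦ (φ, ∇φ)` from `C_c^∞(D)` to `L²(D) × L²(D; ℝ^d)`. -/
def testPair : 𝓓(D.toOpens, ℝ) →ₗ[ℝ] L2 D × L2Vec D where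
  toFun φ := ((memLp_test D φ).toLp φ, (memLp_gradient_test D φ).toLp (gradient φ))
  map_add' φ χ := by
    ext1
    · rfl
    · apply Lp.ext
      filter_upwards [MemLp.coeFn_toLp (memLp_gradient_test D (φ + χ)),
        MemLp.coeFn_toLp (memLp_gradient_test D φ), MemLp.coeFn_toLp (memLp_gradient_test D χ),
        Lp.coeFn_add ((memLp_gradient_test D φ).toLp (gradient φ))
          ((memLp_gradient_test D χ).toLp (gradient χ))] with x h1 h2 h3 h4
      simp only [Prod.snd_add]
      rw [h1, h4, Pi.add_apply, h2, h3]
      have : (⇑(φ + χ) : EuclideanSpace ℝ (Fin d) → ℝ) = ⇑φ + ⇑χ := by ext; simp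
      simp only [gradient]
      rw [this, fderiv_add (differentiable_test D φ x) (differentiable_test D χ x), map_add]
  map_smul' c φ := by
    ext1
    · rfl
    · apply Lp.ext
      filter_upwards [MemLp.coeFn_toLp (memLp_gradient_test D (c • φ)),
        MemLp.coeFn_toLp (memLp_gradient_test D φ),
        Lp.coeFn_smul c ((memLp_gradient_test D φ).toLp (gradient φ))] with x h1 h2 h4
      simp only [Prod.smul_snd, RingHom.id_apply]
      rw [h1, h4, Pi.smul_apply, h2]
      have : (⇑(c • φ) : EuclideanSpace ℝ (Fin d) → ℝ) = c • ⇑φ := by ext; simp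
      simp only [gradient]
      rw [this, fderiv_const_smul (differentiable_test D φ x)]
      simp

end TestFunctions

/-- The pairs `(v, g)` in `L²(D) × L²(D; ℝ^d)` for which there are test functions
`φ_n ∈ C_c^∞(D)` with `φ_n → v` in `L²(D)` and `∇φ_n → g` in `L²(D; ℝ^d)`. -/
def h01Graph (D : BoundedDomain d) : Submodule ℝ (L2 D × L2Vec D) :=
  (LinearMap.range (testPair D)).topologicalClosure

/-- The Sobolev space `H₀¹(D)`: the closure of `C_c^∞(D)` in `H¹(D)`, as a space of functions in
`L²(D)`. It is a type of its own because it carries the norm `‖∇v‖_{L²(D)}`, see below. -/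
def H01 (D : BoundedDomain d) : Type := ↥((h01Graph D).map (LinearMap.fst ℝ (L2 D) (L2Vec D)))

instance (D : BoundedDomain d) : AddCommGroup (H01 D) :=
  inferInstanceAs (AddCommGroup ↥((h01Graph D).map (LinearMap.fst ℝ (L2 D) (L2Vec D))))

instance (D : BoundedDomain d) : Module ℝ (H01 D) :=
  inferInstanceAs (Module ℝ ↥((h01Graph D).map (LinearMap.fst ℝ (L2 D) (L2Vec D))))

/-- The inclusion of `H₀¹(D)` into `L²(D)`. -/
def H01.toL2 (D : BoundedDomain d) : H01 D →ₗ[ℝ] L2 D :=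
  ((h01Graph D).map (LinearMap.fst ℝ (L2 D) (L2Vec D))).subtype

theorem H01.toL2_injective (D : BoundedDomain d) : Function.Injective (H01.toL2 D) :=
  Subtype.val_injective

/-- `g` is the weak gradient of `v` on `D`: `∫_D v ∂_e φ = - ∫_D φ g·e` for every test function
`φ` and every direction `e`. -/
def HasWeakGradient (D : BoundedDomain d) (v : L2 D) (g : L2Vec D) : Prop :=
  ∀ (φ : 𝓓(D.toOpens, ℝ)) (e : EuclideanSpace ℝ (Fin d)),
    ∫ x, v x * fderiv ℝ φ x e ∂D.measure = -∫ x, φ x * ⟪e, g x⟫ ∂D.measure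

theorem hasWeakGradient_of_mem (D : BoundedDomain d) {p : L2 D × L2Vec D}
    (hp : p ∈ h01Graph D) : HasWeakGradient D p.1 p.2 := by
  intro φ e
  have hc1 : Continuous (fun x => fderiv ℝ (φ : EuclideanSpace ℝ (Fin d) → ℝ) x e) :=
    (continuous_fderiv_test D φ).clm_apply continuous_const
  have hs1 : HasCompactSupport (fun x => fderiv ℝ (φ : EuclideanSpace ℝ (Fin d) → ℝ) x e) :=
    φ.hasCompactSupport.fderiv_apply (𝕜 := ℝ) e
  have h1 : MemLp (fun x => fderiv ℝ (φ : EuclideanSpace ℝ (Fin d) → ℝ) x e) 2 D.measure :=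
    (hc1.memLp_of_hasCompactSupport hs1).restrict _
  have hc2 : Continuous (fun x => φ x • e) := φ.continuous.smul continuous_const
  have hs2 : HasCompactSupport (fun x => φ x • e) := φ.hasCompactSupport.smul_right
  have h2 : MemLp (fun x => φ x • e) 2 D.measure :=
    (hc2.memLp_of_hasCompactSupport hs2).restrict _
  have key : ∀ q : L2 D × L2Vec D,
      (⟪h1.toLp _, q.1⟫ + ⟪h2.toLp _, q.2⟫ =
        ∫ x, q.1 x * fderiv ℝ φ x e ∂D.measure + ∫ x, φ x * ⟪e, q.2 x⟫ ∂D.measure) := by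
    intro q
    rw [L2.inner_def, L2.inner_def]
    congr 1
    · apply integral_congr_ae
      filter_upwards [h1.coeFn_toLp] with x hx
      rw [hx]; simp
    · apply integral_congr_ae
      filter_upwards [h2.coeFn_toLp] with x hx
      rw [hx, real_inner_smul_left]
  suffices h : ⟪h1.toLp _, p.1⟫ + ⟪h2.toLp _, p.2⟫ = 0 by
    rw [key] at h; linarith
  have hcl : IsClosed {q : L2 D × L2Vec D | ⟪h1.toLp _, q.1⟫ + ⟪h2.toLp _, q.2⟫ = 0} :=
    isClosed_eq (by fun_prop) continuous_const
  refine closure_minimal ?_ hcl hp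
  rintro _ ⟨χ, rfl⟩
  change ⟪h1.toLp _, (testPair D χ).1⟫ + ⟪h2.toLp _, (testPair D χ).2⟫ = 0
  rw [key]
  have e1 : ∫ x, (testPair D χ).1 x * fderiv ℝ φ x e ∂D.measure
      = ∫ x, χ x * fderiv ℝ φ x e := by
    refine Eq.trans (integral_congr_ae ?_) (setIntegral_eq_integral_of_forall_compl_eq_zero
      (s := (D.toOpens : Set (EuclideanSpace ℝ (Fin d)))) ?_)
    · filter_upwards [(memLp_test D χ).coeFn_toLp] with x hx
      simp only [testPair, LinearMap.coe_mk, AddHom.coe_mk]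
      rw [hx]
    · intro x hx
      rw [image_eq_zero_of_notMem_tsupport (fun h => hx (χ.tsupport_subset h)), zero_mul]
  have e2 : ∫ x, φ x * ⟪e, (testPair D χ).2 x⟫ ∂D.measure
      = ∫ x, fderiv ℝ χ x e * φ x := by
    refine Eq.trans (integral_congr_ae ?_) (setIntegral_eq_integral_of_forall_compl_eq_zero
      (s := (D.toOpens : Set (EuclideanSpace ℝ (Fin d)))) ?_)
    · filter_upwards [(memLp_gradient_test D χ).coeFn_toLp] with x hx
      simp only [testPair, LinearMap.coe_mk, AddHom.coe_mk]
      rw [hx, real_inner_comm, gradient, InnerProductSpace.toDual_symm_apply, mul_comm]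
    · intro x hx
      rw [image_eq_zero_of_notMem_tsupport (f := φ) (fun h => hx (φ.tsupport_subset h)), mul_zero]
  have hc3 : Continuous (fun x => fderiv ℝ (χ : EuclideanSpace ℝ (Fin d) → ℝ) x e) :=
    (continuous_fderiv_test D χ).clm_apply continuous_const
  rw [e1, e2, integral_mul_fderiv_eq_neg_fderiv_mul_of_integrable]
  · ring
  · exact (hc3.mul φ.continuous).integrable_of_hasCompactSupport φ.hasCompactSupport.mul_left
  · exact (χ.continuous.mul hc1).integrable_of_hasCompactSupport χ.hasCompactSupport.mul_right
  · exact (χ.continuous.mul φ.continuous).integrable_of_hasCompactSupport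
      χ.hasCompactSupport.mul_right
  · exact fun x _ => differentiable_test D χ x
  · exact fun x _ => differentiable_test D φ x

theorem HasWeakGradient.eq_zero (D : BoundedDomain d) {g : L2Vec D}
    (h : HasWeakGradient D 0 g) : g = 0 := by
  have hg : LocallyIntegrable g D.measure :=
    (Lp.memLp g).locallyIntegrable (by norm_num)
  have hD : IsOpen (D.toOpens : Set (EuclideanSpace ℝ (Fin d))) := D.toOpens.isOpen
  have hmain : ∀ e : EuclideanSpace ℝ (Fin d), ∀ᵐ x ∂D.measure, ⟪e, g x⟫ = 0 := by
    intro e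
    have hloc : LocallyIntegrableOn (fun x => ⟪e, g x⟫)
        (D.toOpens : Set (EuclideanSpace ℝ (Fin d))) volume := by
      have : IntegrableOn g (D.toOpens : Set (EuclideanSpace ℝ (Fin d))) volume := by
        have : IsFiniteMeasure D.measure :=
          ⟨by rw [Measure.restrict_apply_univ]; exact D.bounded.measure_lt_top⟩
        exact (Lp.memLp g).integrable (by norm_num)
      have h2 : IntegrableOn (fun x => ⟪e, g x⟫)
          (D.toOpens : Set (EuclideanSpace ℝ (Fin d))) volume :=
        Integrable.const_inner (𝕜 := ℝ) e this
      exact h2.locallyIntegrableOn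
    have := hD.ae_eq_zero_of_integral_contDiff_smul_eq_zero hloc (by
      intro φ hφ hs ht
      have h' := h ⟨φ, hφ, hs, ht⟩ e
      have z : ∫ x, ((0 : L2 D) : EuclideanSpace ℝ (Fin d) → ℝ) x *
          fderiv ℝ (⟨φ, hφ, hs, ht⟩ : 𝓓(D.toOpens, ℝ)) x e ∂D.measure = 0 := by
        rw [← integral_zero (EuclideanSpace ℝ (Fin d)) ℝ (μ := D.measure)]
        apply integral_congr_ae
        filter_upwards [Lp.coeFn_zero ℝ 2 D.measure] with x hx
        rw [hx]; simp
      rw [z] at h'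
      have h'' : ∫ x, φ x * ⟪e, g x⟫ ∂D.measure = 0 := by
        have := neg_eq_zero.1 h'.symm
        exact this
      rw [setIntegral_eq_integral_of_forall_compl_eq_zero] at h''
      · exact h''
      · intro x hx
        rw [image_eq_zero_of_notMem_tsupport (fun h => hx (ht h)), zero_mul])
    exact (ae_restrict_iff' hD.measurableSet).2 this
  apply Lp.ext
  have hall : ∀ᵐ x ∂D.measure, ∀ i : Fin d, ⟪EuclideanSpace.single i (1 : ℝ), g x⟫ = 0 :=
    ae_all_iff.2 fun i => hmain _
  filter_upwards [hall, Lp.coeFn_zero (EuclideanSpace ℝ (Fin d)) 2 D.measure] with x hx h0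
  rw [h0]
  ext i
  simpa [EuclideanSpace.inner_single_left] using hx i

/-- The weak gradient on `H₀¹(D)` exists and is unique. -/
theorem H01.existsUnique_grad (D : BoundedDomain d) (v : H01 D) :
    ∃! g : L2Vec D, (H01.toL2 D v, g) ∈ h01Graph D := by
  obtain ⟨p, hp, hv⟩ := v.2
  have hpv : (H01.toL2 D v, p.2) = p := by
    ext1
    · exact hv.symm
    · rfl
  refine ⟨p.2, by simpa [hpv] using hp, fun g hg => ?_⟩
  have := hasWeakGradient_of_mem D ((h01Graph D).sub_mem hg (by simpa [hpv] using hp :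
    (H01.toL2 D v, p.2) ∈ h01Graph D))
  rw [Prod.mk_sub_mk, sub_self] at this
  exact sub_eq_zero.1 this.eq_zero

/-- The weak gradient `∇ : H₀¹(D) → L²(D; ℝ^d)`. -/
def H01.grad (D : BoundedDomain d) : H01 D →ₗ[ℝ] L2Vec D where
  toFun v := (H01.existsUnique_grad D v).choose
  map_add' v w := by
    refine (H01.existsUnique_grad D (v + w)).unique
      (H01.existsUnique_grad D (v + w)).choose_spec.1 ?_
    simpa using (h01Graph D).add_mem (H01.existsUnique_grad D v).choose_spec.1
      (H01.existsUnique_grad D w).choose_spec.1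
  map_smul' c v := by
    refine (H01.existsUnique_grad D (c • v)).unique
      (H01.existsUnique_grad D (c • v)).choose_spec.1 ?_
    simpa using (h01Graph D).smul_mem c (H01.existsUnique_grad D v).choose_spec.1

theorem H01.mem_graph (D : BoundedDomain d) (v : H01 D) :
    (H01.toL2 D v, H01.grad D v) ∈ h01Graph D :=
  (H01.existsUnique_grad D v).choose_spec.1

/-- The Poincaré inequality. -/
theorem poincare (D : BoundedDomain d) :
    ∃ C : ℝ, ∀ p ∈ h01Graph D, ‖p.1‖ ≤ C * ‖p.2‖ := by
  obtain ⟨R, hR⟩ := D.bounded.exists_norm_le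
  have hR0 : 0 ≤ |R| := abs_nonneg R
  refine ⟨2 * |R|, fun p hp => ?_⟩
  have hcl : IsClosed {q : L2 D × L2Vec D | ‖q.1‖ ≤ 2 * |R| * ‖q.2‖} :=
    isClosed_le (by fun_prop) (by fun_prop)
  refine closure_minimal ?_ hcl hp
  rintro _ ⟨φ, rfl⟩
  let i : Fin d := ⟨0, D.dim_pos⟩
  let e : EuclideanSpace ℝ (Fin d) := EuclideanSpace.single i 1
  have hx_diff : Differentiable ℝ (fun x : EuclideanSpace ℝ (Fin d) => ⟪e, x⟫) :=
    (innerSL ℝ e).differentiable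
  have hx_cont : Continuous (fun x : EuclideanSpace ℝ (Fin d) => ⟪e, x⟫) := by fun_prop
  have hx_fd : ∀ x, fderiv ℝ (fun x : EuclideanSpace ℝ (Fin d) => ⟪e, x⟫) x e = 1 := by
    intro x
    have : HasFDerivAt (fun x : EuclideanSpace ℝ (Fin d) => ⟪e, x⟫) (innerSL ℝ e) x :=
      (innerSL ℝ e).hasFDerivAt
    rw [this.fderiv]
    simp [e]
  have hc1 : Continuous (fun x => fderiv ℝ (φ : EuclideanSpace ℝ (Fin d) → ℝ) x e) :=
    (continuous_fderiv_test D φ).clm_apply continuous_const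
  have hs1 : HasCompactSupport (fun x => fderiv ℝ (φ : EuclideanSpace ℝ (Fin d) → ℝ) x e) :=
    φ.hasCompactSupport.fderiv_apply (𝕜 := ℝ) e
  have hfd : ∀ x, fderiv ℝ (fun x => ⟪e, x⟫ * φ x) x e
      = ⟪e, x⟫ * fderiv ℝ φ x e + φ x := by
    intro x
    rw [fderiv_fun_mul (hx_diff x) (differentiable_test D φ x)]
    simp [hx_fd]
  have hI1 : Integrable (fun x => ⟪e, x⟫ * φ x * fderiv ℝ φ x e) :=
    ((hx_cont.mul φ.continuous).mul hc1).integrable_of_hasCompactSupport hs1.mul_left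
  have hI2 : Integrable (fun x => φ x * φ x) :=
    (φ.continuous.mul φ.continuous).integrable_of_hasCompactSupport φ.hasCompactSupport.mul_left
  have hI3 : Integrable (fun x => ⟪e, x⟫ * φ x * φ x) :=
    ((hx_cont.mul φ.continuous).mul φ.continuous).integrable_of_hasCompactSupport
      φ.hasCompactSupport.mul_left
  have hI4 : Integrable (fun x => fderiv ℝ (fun x => ⟪e, x⟫ * φ x) x e * φ x) := by
    refine (hI1.add hI2).congr (Eventually.of_forall fun x => ?_)
    simp only [hfd, Pi.add_apply]; ring
  have ibp := integral_mul_fderiv_eq_neg_fderiv_mul_of_integrable hI4 hI1 hI3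
    (fun x _ => (hx_diff x).mul (differentiable_test D φ x))
    (fun x _ => differentiable_test D φ x)
  have hsum : ∫ x, fderiv ℝ (fun x => ⟪e, x⟫ * φ x) x e * φ x
      = (∫ x, ⟪e, x⟫ * φ x * fderiv ℝ φ x e) + ∫ x, φ x * φ x := by
    rw [← integral_add hI1 hI2]
    congr 1; ext x; rw [hfd]; ring
  rw [hsum] at ibp
  have hsq : ∫ x, φ x * φ x = -2 * ∫ x, φ x * (⟪e, x⟫ * fderiv ℝ φ x e) := by
    have : ∫ x, φ x * (⟪e, x⟫ * fderiv ℝ φ x e) = ∫ x, ⟪e, x⟫ * φ x * fderiv ℝ φ x e := by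
      congr 1; ext x; ring
    rw [this]; linarith
  have hm : MemLp (fun x => ⟪e, x⟫ * fderiv ℝ (φ : EuclideanSpace ℝ (Fin d) → ℝ) x e) 2
      D.measure :=
    ((hx_cont.mul hc1).memLp_of_hasCompactSupport hs1.mul_left).restrict _
  have hout : ∀ x, x ∉ (D.toOpens : Set (EuclideanSpace ℝ (Fin d))) → φ x = 0 := fun x hx =>
    image_eq_zero_of_notMem_tsupport (fun h => hx (φ.tsupport_subset h))
  set F : L2 D := (memLp_test D φ).toLp φ with hF
  set H : L2 D := hm.toLp _ with hH
  set G : L2Vec D := (memLp_gradient_test D φ).toLp (gradient φ) with hG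
  have hFF : ⟪F, F⟫ = ∫ x, φ x * φ x := by
    rw [L2.inner_def]
    refine Eq.trans (integral_congr_ae ?_) (setIntegral_eq_integral_of_forall_compl_eq_zero
      (s := (D.toOpens : Set (EuclideanSpace ℝ (Fin d))))
      (fun x hx => by rw [hout x hx, zero_mul]))
    filter_upwards [(memLp_test D φ).coeFn_toLp] with x hx
    rw [hF, hx]; simp [sq]
  have hFH : ⟪F, H⟫ = ∫ x, φ x * (⟪e, x⟫ * fderiv ℝ φ x e) := by
    rw [L2.inner_def]
    refine Eq.trans (integral_congr_ae ?_) (setIntegral_eq_integral_of_forall_compl_eq_zero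
      (s := (D.toOpens : Set (EuclideanSpace ℝ (Fin d))))
      (fun x hx => by rw [hout x hx, zero_mul]))
    filter_upwards [(memLp_test D φ).coeFn_toLp, hm.coeFn_toLp] with x hx hx'
    rw [hF, hH, hx, hx']; simp [mul_comm]
  have hHG : ‖H‖ ≤ |R| * ‖G‖ := by
    apply Lp.norm_le_mul_norm_of_ae_le_mul
    filter_upwards [hm.coeFn_toLp, (memLp_gradient_test D φ).coeFn_toLp,
      ae_restrict_mem D.toOpens.isOpen.measurableSet] with x h1 h2 hxD
    rw [hH, hG, h1, h2, norm_mul]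
    have he : ‖e‖ = 1 := by simp [e]
    refine mul_le_mul ?_ ?_ (norm_nonneg _) hR0
    · calc ‖⟪e, x⟫‖ ≤ ‖e‖ * ‖x‖ := norm_inner_le_norm _ _
        _ ≤ |R| := by rw [he, one_mul]; exact (hR x hxD).trans (le_abs_self R)
    · have : fderiv ℝ (φ : EuclideanSpace ℝ (Fin d) → ℝ) x e = ⟪gradient φ x, e⟫ := by
        rw [gradient, InnerProductSpace.toDual_symm_apply]
      rw [this]
      calc ‖⟪gradient φ x, e⟫‖ ≤ ‖gradient φ x‖ * ‖e‖ := norm_inner_le_norm _ _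
        _ = ‖gradient φ x‖ := by rw [he, mul_one]
  have h1 : ‖F‖ * ‖F‖ ≤ ‖F‖ * (2 * |R| * ‖G‖) := by
    calc ‖F‖ * ‖F‖ = -2 * ⟪F, H⟫ := by
          rw [← real_inner_self_eq_norm_mul_norm, hFF, hsq, hFH]
      _ ≤ 2 * |⟪F, H⟫| := by nlinarith [neg_abs_le ⟪F, H⟫]
      _ ≤ 2 * (‖F‖ * ‖H‖) := by gcongr; exact abs_real_inner_le_norm F H
      _ ≤ 2 * (‖F‖ * (|R| * ‖G‖)) := by gcongr
      _ = ‖F‖ * (2 * |R| * ‖G‖) := by ring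
  change ‖F‖ ≤ 2 * |R| * ‖G‖
  rcases (norm_nonneg F).eq_or_lt with h0 | h0
  · rw [← h0]; positivity
  · exact le_of_mul_le_mul_left h1 h0

theorem H01.grad_injective (D : BoundedDomain d) : Function.Injective (H01.grad D) := by
  rw [injective_iff_map_eq_zero]
  intro v hv
  obtain ⟨C, hC⟩ := poincare D
  have := hC _ (H01.mem_graph D v)
  simp only [hv, norm_zero, mul_zero] at this
  apply H01.toL2_injective D
  rw [map_zero]
  exact norm_le_zero_iff.1 this

/-- `V = H₀¹(D)` carries the norm `‖v‖_V = ‖∇v‖_{L²(D)}`. -/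
instance (D : BoundedDomain d) : NormedAddCommGroup (H01 D) :=
  NormedAddCommGroup.induced (H01 D) (L2Vec D) (H01.grad D) (H01.grad_injective D)

theorem H01.norm_def (D : BoundedDomain d) (v : H01 D) : ‖v‖ = ‖H01.grad D v‖ := rfl

instance (D : BoundedDomain d) : InnerProductSpace ℝ (H01 D) where
  toModule := inferInstance
  norm_smul_le c v := by
    rw [H01.norm_def, H01.norm_def, map_smul, norm_smul]
  inner v w := ⟪H01.grad D v, H01.grad D w⟫
  norm_sq_eq_re_inner v := by
    rw [H01.norm_def, ← real_inner_self_eq_norm_sq]; rfl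
  conj_inner_symm v w := by simp [real_inner_comm]
  add_left v w z := by simp [inner_add_left]
  smul_left v w c := by simp [real_inner_smul_left]

/-- The parameter domain `U = [-1/2, 1/2]^ℕ`; the parameters are indexed from `0`. -/
def paramDomain : Set (ℕ → ℝ) := Set.univ.pi fun _ => Icc (-1 / 2) (1 / 2)

/-- The diffusion coefficient `a(x, y) = a₀(x) + ∑_j y_j ψ_j(x)`. -/
def coeff (a₀ : EuclideanSpace ℝ (Fin d) → ℝ) (ψ : ℕ → EuclideanSpace ℝ (Fin d) → ℝ)
    (y : ℕ → ℝ) (x : EuclideanSpace ℝ (Fin d)) : ℝ :=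
  a₀ x + ∑' j, y j * ψ j x

/-- The bilinear form `A(y; w, v) = ∫_D a(x, y) ∇w(x)·∇v(x) dx`. -/
def bilinForm (D : BoundedDomain d) (a₀ : EuclideanSpace ℝ (Fin d) → ℝ)
    (ψ : ℕ → EuclideanSpace ℝ (Fin d) → ℝ) (y : ℕ → ℝ) (w v : H01 D) : ℝ :=
  ∫ x, coeff a₀ ψ y x * ⟪H01.grad D w x, H01.grad D v x⟫ ∂D.measure

/-- `w ∈ V` is a weak solution of `-∇·(a(·, y) ∇w) = f` with zero boundary values. -/
def IsWeakSolution (D : BoundedDomain d) (a₀ : EuclideanSpace ℝ (Fin d) → ℝ)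
    (ψ : ℕ → EuclideanSpace ℝ (Fin d) → ℝ) (f : StrongDual ℝ (H01 D)) (y : ℕ → ℝ)
    (w : H01 D) : Prop :=
  ∀ v : H01 D, bilinForm D a₀ ψ y w v = f v

/-- `‖∑_j (|ψ_j| / b_j) / (2 a₀)‖_{L^∞(D)}`, as an extended nonnegative number. -/
def kappa (D : BoundedDomain d) (a₀ : EuclideanSpace ℝ (Fin d) → ℝ)
    (ψ : ℕ → EuclideanSpace ℝ (Fin d) → ℝ) (b : ℕ → ℝ) : ℝ≥0∞ :=
  eLpNorm (fun x => ∑' j, ENNReal.ofReal (|ψ j x| / b j / (2 * a₀ x))) ∞ D.measure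

/-- `κ̃(ν) = ‖∑_{j ∈ supp ν} (|ψ_j| / b_j) / (2 a₀)‖_{L^∞(D)}`. -/
def kappaTilde (D : BoundedDomain d) (a₀ : EuclideanSpace ℝ (Fin d) → ℝ)
    (ψ : ℕ → EuclideanSpace ℝ (Fin d) → ℝ) (b : ℕ → ℝ) (ν : ℕ →₀ ℕ) : ℝ :=
  (eLpNorm (fun x => ∑ j ∈ ν.support, |ψ j x| / b j / (2 * a₀ x)) ∞ D.measure).toReal

/-- The monomial `b^ν = ∏_j b_j^{ν_j}`. -/
def monom (b : ℕ → ℝ) (ν : ℕ →₀ ℕ) : ℝ := ν.prod fun j n => b j ^ n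

/-- The partial derivative `∂g/∂y_j` of a function on `U` (one-sided where
`y_j = ±1/2`). -/
def partialDeriv {W : Type*} [NormedAddCommGroup W] [NormedSpace ℝ W] (j : ℕ)
    (g : (ℕ → ℝ) → W) (y : ℕ → ℝ) : W :=
  derivWithin (fun t => g (Function.update y j t)) (Icc (-1 / 2) (1 / 2)) (y j)

/-- The mixed partial derivative `∂^ν g = ∂^{|ν|} g / ∂y_0^{ν_0} ∂y_1^{ν_1} ⋯`. -/
def mixedDeriv {W : Type*} [NormedAddCommGroup W] [NormedSpace ℝ W] (ν : ℕ →₀ ℕ)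
    (g : (ℕ → ℝ) → W) : (ℕ → ℝ) → W :=
  (ν.support.sort (· ≤ ·)).foldr (fun j h => (partialDeriv j)^[ν j] h) g

end ParametricDiffusion

end

open ParametricDiffusion

/-! Riesz representation in `V` turns the weak problem into `A y (u y) = F`, where `A y` is affine
in each coordinate `y j`, with slope the operator `P j` of the coefficient `ψ j`. Since `|a - a₀| ≤
κbar * a₀`, the operator `A y` is coercive, hence invertible by Lax–Milgram.

Formal differentiation gives the recursion `A W_s = -∑_{j ∈ s} P_j W_{s \ {j}}` with `A W_∅ = F`.
Its solutions are indexed by finite sets, so the identity `∂_i W_s = W_{s ∪ {i}}` for `i ∉ s`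
(`hasDerivWithinAt_sensitivity`) yields both the existence of the mixed derivatives and their
independence of the order.

The bound has no factorial because all derivatives of order `k` are estimated together, in the
energy `e(w) = ∫ a₀ |∇w|²`. Put `X_s = b^{-s} W_s`, test the equation of `X_s` with `X_s` itself,
split every term by Young's inequality with the pointwise weight `|ψ_j| / b_j`, and sum over all `s
⊆ supp ν` of size `k + 1`. After double counting, `X_s` carries the weights with `j ∈ s`, and each
`X_t` of size `k` those with `j ∉ t`; either sum of weights is at most `2 κ̃(ν) a₀`. The best Young
parameter then gives a factor `(2 κ̃(ν) / (1 - κbar))²` per order (`sum_energy_succ_le`). Order zero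
is the a priori estimate `energy_solution_le`, and `a₀min * ‖w‖² ≤ e(w)` leads back to the norm of
`V`. -/

namespace ParametricDiffusion

/-! ### Affine families of invertible operators -/

section Sensitivity

variable {E : Type*} [NormedAddCommGroup E] [NormedSpace ℝ E]

/-- The candidates `W_s` for the mixed first derivatives `∂^s u` of `u(y) = A(y)⁻¹ F`, where
`∂_j A = P_j`: they solve `A W_∅ = F` and `A W_s = -∑_{j ∈ s} P_j W_{s \ {j}}`. -/
noncomputable def sensitivity (A : (ℕ → ℝ) → E →L[ℝ] E) (P : ℕ → E →L[ℝ] E) (F : E)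
    (s : Finset ℕ) (y : ℕ → ℝ) : E :=
  Ring.inverse (A y) ((if s = ∅ then F else 0) -
    ∑ j ∈ s.attach, P j (sensitivity A P F (s.erase j) y))
termination_by s.card
decreasing_by exact Finset.card_erase_lt_of_mem j.2

variable {A : (ℕ → ℝ) → E →L[ℝ] E} {P : ℕ → E →L[ℝ] E} {F : E}

theorem sensitivity_eq (s : Finset ℕ) (y : ℕ → ℝ) :
    sensitivity A P F s y = Ring.inverse (A y) ((if s = ∅ then F else 0) -
      ∑ j ∈ s, P j (sensitivity A P F (s.erase j) y)) := by
  rw [sensitivity, Finset.sum_attach s fun j => P j (sensitivity A P F (s.erase j) y)]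

theorem apply_sensitivity {y : ℕ → ℝ} (hA : IsUnit (A y)) (s : Finset ℕ) :
    A y (sensitivity A P F s y) = (if s = ∅ then F else 0) -
      ∑ j ∈ s, P j (sensitivity A P F (s.erase j) y) := by
  rw [sensitivity_eq]
  exact DFunLike.congr_fun (Ring.mul_inverse_cancel _ hA) _

theorem update_mem_paramDomain {y : ℕ → ℝ} (hy : y ∈ paramDomain) (i : ℕ) {t : ℝ}
    (ht : t ∈ Icc (-1 / 2 : ℝ) (1 / 2)) : Function.update y i t ∈ paramDomain := by
  intro j _
  rcases eq_or_ne j i with rfl | h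
  · simpa using ht
  · simpa [h] using hy j (mem_univ j)

variable [CompleteSpace E]

/-- Along one coordinate `A` is affine, so this is the chain rule with the derivative `H ↦ -A⁻¹ H
A⁻¹` of inversion. The derivative is taken within the interval, which makes it one-sided at the end
points. -/
theorem hasDerivWithinAt_inverse
    (hstep : ∀ y ∈ paramDomain, ∀ i, ∀ t ∈ Icc (-1 / 2 : ℝ) (1 / 2),
      A (Function.update y i t) = A y + (t - y i) • P i)
    {y : ℕ → ℝ} (hy : y ∈ paramDomain) (hA : IsUnit (A y)) (i : ℕ) :
    HasDerivWithinAt (fun t => Ring.inverse (A (Function.update y i t)))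
      (-(Ring.inverse (A y) * P i * Ring.inverse (A y))) (Icc (-1 / 2) (1 / 2)) (y i) := by
  obtain ⟨x, hx⟩ := hA
  have hlin : HasDerivWithinAt (fun t : ℝ => A y + (t - y i) • P i) (P i)
      (Icc (-1 / 2) (1 / 2)) (y i) := by
    simpa using ((((hasDerivAt_id (y i)).sub_const (y i)).smul_const (P i)).const_add
      (A y)).hasDerivWithinAt
  have hinv : HasFDerivAt Ring.inverse
      (-((ContinuousLinearMap.mulLeftRight ℝ (E →L[ℝ] E)) ↑x⁻¹) ↑x⁻¹)
      (A y + (y i - y i) • P i) := by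
    rw [sub_self, zero_smul, add_zero, ← hx]
    exact hasFDerivAt_ringInverse x
  have h := hinv.comp_hasDerivWithinAt (y i) hlin
  have e : -(Ring.inverse (A y) * P i * Ring.inverse (A y)) =
      (-((ContinuousLinearMap.mulLeftRight ℝ (E →L[ℝ] E)) ↑x⁻¹) ↑x⁻¹) (P i) := by
    rw [← hx, Ring.inverse_unit]
    simp
  rw [e]
  exact h.congr (fun t ht => by simp [hstep y hy i t ht]) (by simp)

/-- Product rule for `A⁻¹ R_s`, with `R_s` the right-hand side of the recursion: the derivative of
`A⁻¹` contributes `-A⁻¹ P_i W_s`, the term `j = i` of the recursion for `insert i s`, and the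
derivative of `R_s` contributes, by induction on the cardinality, the terms with `j ∈ s`. -/
theorem hasDerivWithinAt_sensitivity (hA : ∀ y ∈ paramDomain, IsUnit (A y))
    (hstep : ∀ y ∈ paramDomain, ∀ i, ∀ t ∈ Icc (-1 / 2 : ℝ) (1 / 2),
      A (Function.update y i t) = A y + (t - y i) • P i)
    (i : ℕ) (s : Finset ℕ) (hi : i ∉ s) {y : ℕ → ℝ} (hy : y ∈ paramDomain) :
    HasDerivWithinAt (fun t => sensitivity A P F s (Function.update y i t))
      (sensitivity A P F (insert i s) y) (Icc (-1 / 2) (1 / 2)) (y i) := by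
  induction hn : s.card using Nat.strong_induction_on generalizing s with
  | _ n ih =>
    subst hn
    have hsum : HasDerivWithinAt (fun t => (if s = ∅ then F else 0) -
        ∑ j ∈ s, P j (sensitivity A P F (s.erase j) (Function.update y i t)))
        (-∑ j ∈ s, P j (sensitivity A P F ((insert i s).erase j) y))
        (Icc (-1 / 2) (1 / 2)) (y i) := by
      refine (HasDerivWithinAt.fun_sum fun j hj => ?_).const_sub _
      have hij : i ≠ j := fun h => hi (h ▸ hj)
      rw [Finset.erase_insert_of_ne hij]
      exact (P j).hasFDerivAt.comp_hasDerivWithinAt (y i)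
        (ih _ (Finset.card_erase_lt_of_mem hj) (s.erase j)
          (fun h => hi (Finset.mem_of_mem_erase h)) rfl)
    have h := (hasDerivWithinAt_inverse hstep hy (hA y hy) i).clm_apply hsum
    simp only [Function.update_eq_self] at h
    simp_rw [sensitivity_eq s]
    convert h using 1
    rw [sensitivity_eq (insert i s), Finset.sum_insert hi, Finset.erase_insert hi,
      if_neg (Finset.insert_ne_empty i s), sensitivity_eq s y]
    simp only [neg_apply, mul_apply_eq_comp, map_sub, map_neg,
      map_add, zero_sub]
    abel

/-- The list is decoupled from the support of `ω` so that induction can shorten it. The right-hand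
side sees only the underlying set, so the order of differentiation is irrelevant. -/
theorem foldr_partialDeriv_eq (hA : ∀ y ∈ paramDomain, IsUnit (A y))
    (hstep : ∀ y ∈ paramDomain, ∀ i, ∀ t ∈ Icc (-1 / 2 : ℝ) (1 / 2),
      A (Function.update y i t) = A y + (t - y i) • P i)
    {u : (ℕ → ℝ) → E} (hu : ∀ y ∈ paramDomain, A y (u y) = F) {ω : ℕ →₀ ℕ} (l : List ℕ)
    (hl : l.Nodup) (hω : ∀ j ∈ l, ω j = 1) {y : ℕ → ℝ} (hy : y ∈ paramDomain) :
    l.foldr (fun j h => (partialDeriv j)^[ω j] h) u y = sensitivity A P F l.toFinset y := by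
  induction l generalizing y with
  | nil =>
    rw [List.foldr_nil, List.toFinset_nil, sensitivity_eq]
    simp only [if_true, Finset.sum_empty, sub_zero, ← hu y hy]
    exact (DFunLike.congr_fun (Ring.inverse_mul_cancel _ (hA y hy)) (u y)).symm
  | cons j l ih =>
    have hjl := List.nodup_cons.1 hl
    rw [List.foldr_cons, hω j (by simp), Function.iterate_one, partialDeriv, List.toFinset_cons]
    have hyj : y j ∈ Icc (-1 / 2 : ℝ) (1 / 2) := hy j (mem_univ j)
    refine HasDerivWithinAt.derivWithin ?_ (uniqueDiffOn_Icc (by norm_num) _ hyj)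
    have hd := hasDerivWithinAt_sensitivity (F := F) hA hstep j l.toFinset (by simpa using hjl.1) hy
    -- A derivative within the interval sees only values on the segment, all of which lie in
    -- `paramDomain`; there the induction hypothesis identifies the inner derivatives.
    exact hd.congr
      (fun t ht => ih hjl.2 (fun i hi => hω i (by simp [hi])) (update_mem_paramDomain hy j ht))
      (ih hjl.2 (fun i hi => hω i (by simp [hi])) (update_mem_paramDomain hy j hyj))

theorem mixedDeriv_eq_sensitivity (hA : ∀ y ∈ paramDomain, IsUnit (A y))
    (hstep : ∀ y ∈ paramDomain, ∀ i, ∀ t ∈ Icc (-1 / 2 : ℝ) (1 / 2),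
      A (Function.update y i t) = A y + (t - y i) • P i)
    {u : (ℕ → ℝ) → E} (hu : ∀ y ∈ paramDomain, A y (u y) = F) {ω : ℕ →₀ ℕ}
    (hω : ∀ j, ω j ≤ 1) {y : ℕ → ℝ} (hy : y ∈ paramDomain) :
    mixedDeriv ω u y = sensitivity A P F ω.support y := by
  rw [mixedDeriv, foldr_partialDeriv_eq hA hstep hu _ (Finset.sort_nodup _ _) _ hy,
    Finset.sort_toFinset]
  intro j hj
  have : ω j ≠ 0 := by simpa using hj
  have := hω j
  omega

end Sensitivity

/-! ### The energy estimate -/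

section Energy

/-- Double counting: pairs `(s, j)` with `j ∈ s` correspond to pairs `(t, j)` with `j ∉ t` through
`t = s \ {j}`. -/
theorem sum_powersetCard_succ_sum_erase {ι M : Type*} [DecidableEq ι] [AddCommMonoid M]
    (N : Finset ι) (k : ℕ) (g : ι → Finset ι → M) :
    ∑ s ∈ N.powersetCard (k + 1), ∑ j ∈ s, g j (s.erase j) =
      ∑ t ∈ N.powersetCard k, ∑ j ∈ N \ t, g j t := by
  rw [Finset.sum_sigma', Finset.sum_sigma']
  refine Finset.sum_bij' (fun p _ => ⟨p.1.erase p.2, p.2⟩) (fun p _ => ⟨insert p.2 p.1, p.2⟩)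
    ?_ ?_ ?_ ?_ ?_
  · rintro ⟨s, j⟩ h
    simp only [Finset.mem_sigma, Finset.mem_powersetCard, Finset.mem_sdiff] at h ⊢
    obtain ⟨⟨hs, hc⟩, hj⟩ := h
    refine ⟨⟨(Finset.erase_subset _ _).trans hs, ?_⟩, hs hj, by simp⟩
    rw [Finset.card_erase_of_mem hj, hc, Nat.add_sub_cancel]
  · rintro ⟨t, j⟩ h
    simp only [Finset.mem_sigma, Finset.mem_powersetCard, Finset.mem_sdiff] at h ⊢
    obtain ⟨⟨ht, hc⟩, hj, hjt⟩ := h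
    refine ⟨⟨Finset.insert_subset hj ht, ?_⟩, by simp⟩
    rw [Finset.card_insert_of_notMem hjt, hc]
  · rintro ⟨s, j⟩ h
    simp only [Finset.mem_sigma] at h
    simp [Finset.insert_erase h.2]
  · rintro ⟨t, j⟩ h
    simp only [Finset.mem_sigma, Finset.mem_sdiff] at h
    simp [Finset.erase_insert h.2.2]
  · rintro ⟨s, j⟩ _
    rfl

theorem le_sq_mul_of_forall_young {c θ T S : ℝ} (hc : 0 < c) (hθ : 0 ≤ θ)
    (h : ∀ r > 0, c * T ≤ r / 2 * (θ * T) + 1 / (2 * r) * (θ * S)) :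
    T ≤ (θ / c) ^ 2 * S := by
  rcases hθ.eq_or_lt with rfl | hθ
  -- For `θ = 0` the optimal `r = c / θ` is not available, but any positive `r` already forces `T ≤
  -- 0`.
  · have := h 1 one_pos
    have : c * T ≤ 0 := by linarith
    have : T ≤ 0 := by nlinarith
    simpa using this
  -- With this `r` the first term is `c / 2 * T`, half of the left-hand side, and can be absorbed.
  · have h1 := h (c / θ) (by positivity)
    have h2 : c / θ / 2 * (θ * T) + 1 / (2 * (c / θ)) * (θ * S) =
        c / 2 * T + c / 2 * ((θ / c) ^ 2 * S) := by
      field_simp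
    rw [h2] at h1
    have h3 : c / 2 * T ≤ c / 2 * ((θ / c) ^ 2 * S) := by linarith
    exact le_of_mul_le_mul_left h3 (by positivity)

variable {ι E : Type*} [DecidableEq ι] [NormedAddCommGroup E] [InnerProductSpace ℝ E]
  {A : E →L[ℝ] E} {Q : ι → E →L[ℝ] E} {X : Finset ι → E} {N : Finset ι} {e : E → ℝ}
  {q : ι → E → ℝ} {c θ : ℝ}

/-- The gain of one order. The same `r` serves all `s` and `j`, so it can be optimised after
summation; the bound `hq` on the sum of the `q j` replaces term-by-term bounds, which would bring in
a count of the elements of `s`. -/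
theorem sum_energy_succ_le (hc : 0 < c) (hθ : 0 ≤ θ)
    (hX : ∀ s, s.Nonempty → A (X s) = -∑ j ∈ s, Q j (X (s.erase j)))
    (hcoer : ∀ w, c * e w ≤ ⟪A w, w⟫) (hq0 : ∀ j w, 0 ≤ q j w)
    (hq : ∀ w, ∑ j ∈ N, q j w ≤ θ * e w)
    (hQ : ∀ j w v, ∀ r > 0, -⟪Q j w, v⟫ ≤ r / 2 * q j v + 1 / (2 * r) * q j w) (k : ℕ) :
    ∑ s ∈ N.powersetCard (k + 1), e (X s) ≤
      (θ / c) ^ 2 * ∑ s ∈ N.powersetCard k, e (X s) := by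
  have hsub : ∀ s ⊆ N, ∀ w, ∑ j ∈ s, q j w ≤ θ * e w := fun s hs w =>
    (Finset.sum_le_sum_of_subset_of_nonneg hs fun j _ _ => hq0 j w).trans (hq w)
  refine le_sq_mul_of_forall_young hc hθ fun r hr => ?_
  calc c * ∑ s ∈ N.powersetCard (k + 1), e (X s)
      ≤ ∑ s ∈ N.powersetCard (k + 1), (r / 2 * ∑ j ∈ s, q j (X s) +
          1 / (2 * r) * ∑ j ∈ s, q j (X (s.erase j))) := by
        rw [Finset.mul_sum]
        refine Finset.sum_le_sum fun s hs => ?_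
        have hne : s.Nonempty := by
          rw [← Finset.card_pos, (Finset.mem_powersetCard.1 hs).2]
          omega
        refine (hcoer (X s)).trans ?_
        rw [hX s hne, inner_neg_left, sum_inner, ← Finset.sum_neg_distrib, Finset.mul_sum,
          Finset.mul_sum, ← Finset.sum_add_distrib]
        exact Finset.sum_le_sum fun j _ => hQ j _ _ r hr
    _ = r / 2 * ∑ s ∈ N.powersetCard (k + 1), ∑ j ∈ s, q j (X s) +
          1 / (2 * r) * ∑ t ∈ N.powersetCard k, ∑ j ∈ N \ t, q j (X t) := by
        rw [← sum_powersetCard_succ_sum_erase N k fun j t => q j (X t), Finset.sum_add_distrib,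
          Finset.mul_sum, Finset.mul_sum]
    _ ≤ r / 2 * (θ * ∑ s ∈ N.powersetCard (k + 1), e (X s)) +
          1 / (2 * r) * (θ * ∑ t ∈ N.powersetCard k, e (X t)) := by
        rw [Finset.mul_sum _ _ θ, Finset.mul_sum _ _ θ]
        gcongr with s hs t ht
        · exact hsub s (Finset.mem_powersetCard.1 hs).1 _
        · exact hsub _ Finset.sdiff_subset _

theorem sum_energy_le (hc : 0 < c) (hθ : 0 ≤ θ)
    (hX : ∀ s, s.Nonempty → A (X s) = -∑ j ∈ s, Q j (X (s.erase j)))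
    (hcoer : ∀ w, c * e w ≤ ⟪A w, w⟫) (hq0 : ∀ j w, 0 ≤ q j w)
    (hq : ∀ w, ∑ j ∈ N, q j w ≤ θ * e w)
    (hQ : ∀ j w v, ∀ r > 0, -⟪Q j w, v⟫ ≤ r / 2 * q j v + 1 / (2 * r) * q j w) (k : ℕ) :
    ∑ s ∈ N.powersetCard k, e (X s) ≤ ((θ / c) ^ k) ^ 2 * e (X ∅) := by
  induction k with
  | zero => simp
  | succ k ih =>
    refine (sum_energy_succ_le hc hθ hX hcoer hq0 hq hQ k).trans ?_
    calc (θ / c) ^ 2 * ∑ s ∈ N.powersetCard k, e (X s)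
        ≤ (θ / c) ^ 2 * (((θ / c) ^ k) ^ 2 * e (X ∅)) := by gcongr
      _ = ((θ / c) ^ (k + 1)) ^ 2 * e (X ∅) := by ring

theorem energy_solution_le {α : ℝ} {F w : E} (hc : 0 < c) (hα : 0 < α)
    (hcoer : c * e w ≤ ⟪A w, w⟫) (he : α * ‖w‖ ^ 2 ≤ e w) (hw : A w = F) :
    e w ≤ ‖F‖ ^ 2 / (c ^ 2 * α) := by
  rw [hw] at hcoer
  have h1 := hcoer.trans (real_inner_le_norm F w)
  have h2 : ‖F‖ * ‖w‖ ≤ ‖F‖ ^ 2 / (2 * c * α) + c * α / 2 * ‖w‖ ^ 2 := by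
    have h3 : ‖F‖ ^ 2 / (2 * c * α) + c * α / 2 * ‖w‖ ^ 2 - ‖F‖ * ‖w‖ =
        (‖F‖ - c * α * ‖w‖) ^ 2 / (2 * c * α) := by
      field_simp
      ring
    have : 0 ≤ (‖F‖ - c * α * ‖w‖) ^ 2 / (2 * c * α) := by positivity
    linarith
  have h4 : c * α / 2 * ‖w‖ ^ 2 ≤ c / 2 * e w := by nlinarith
  have h5 : c / 2 * e w ≤ c / 2 * (‖F‖ ^ 2 / (c ^ 2 * α)) := by
    have : c / 2 * (‖F‖ ^ 2 / (c ^ 2 * α)) = ‖F‖ ^ 2 / (2 * c * α) := by field_simp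
    rw [this]
    linarith
  exact le_of_mul_le_mul_left h5 (by positivity)

/-- Lax–Milgram, applied to the bilinear form `⟪T w, v⟫`. -/
theorem isUnit_of_coercive [CompleteSpace E] {T : E →L[ℝ] E} {C : ℝ} (hC : 0 < C)
    (hT : ∀ w, C * ‖w‖ ^ 2 ≤ ⟪T w, w⟫) : IsUnit T := by
  let B : E →L[ℝ] E →L[ℝ] ℝ := (innerSL ℝ).comp T
  have hB : IsCoercive B := ⟨C, hC, fun w => by
    have := hT w
    simp only [B, ContinuousLinearMap.comp_apply, innerSL_apply_apply]
    nlinarith⟩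
  rw [ContinuousLinearMap.isUnit_iff_bijective]
  convert hB.continuousLinearEquivOfBilin.bijective using 1
  ext w
  refine ext_inner_right ℝ fun v => ?_
  rw [IsCoercive.continuousLinearEquivOfBilin_apply]
  simp [B]

end Energy

end ParametricDiffusion

namespace ParametricDiffusion

/-! ### Multiplication operators on `H₀¹(D)` -/

section Operators

variable {d : ℕ} {D : BoundedDomain d}

/-- The weak gradient as a continuous linear map. -/
noncomputable def gradL (D : BoundedDomain d) : H01 D →L[ℝ] L2Vec D :=
  (H01.grad D).mkContinuous 1 fun v => by rw [one_mul, H01.norm_def]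

/-- This carries the completeness of `H01 D`, whose norm is induced by the gradient. By Poincaré,
convergence of the gradients makes the functions Cauchy in `L²`, and the graph is closed. -/
theorem isClosed_range_grad (D : BoundedDomain d) : IsClosed (range (H01.grad D)) := by
  refine isClosed_of_closure_subset fun g hg => ?_
  obtain ⟨C, hC⟩ := poincare D
  obtain ⟨G, hG, hlim⟩ := mem_closure_iff_seq_limit.1 hg
  choose v hv using hG
  have hcauchy : CauchySeq fun n => H01.toL2 D (v n) := by
    -- The constant from `poincare` comes without a sign; `max C 0` makes it nonnegative.
    have hGc : CauchySeq fun n => (max C 0) • G n := (hlim.const_smul (max C 0)).cauchySeq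
    rw [Metric.cauchySeq_iff'] at hGc ⊢
    intro ε hε
    obtain ⟨M, hM⟩ := hGc ε hε
    refine ⟨M, fun n hn => lt_of_le_of_lt ?_ (hM n hn)⟩
    rw [dist_eq_norm, dist_eq_norm, ← smul_sub, norm_smul, ← map_sub, ← hv, ← hv, ← map_sub,
      Real.norm_of_nonneg (le_max_right C 0)]
    exact (hC _ (H01.mem_graph D (v n - v M))).trans
      (mul_le_mul_of_nonneg_right (le_max_left C 0) (norm_nonneg _))
  obtain ⟨w, hw⟩ := cauchySeq_tendsto_of_complete hcauchy
  have hmem : (w, g) ∈ h01Graph D := by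
    refine (Submodule.isClosed_topologicalClosure _).mem_of_tendsto (hw.prodMk_nhds hlim)
      (Eventually.of_forall fun n => ?_)
    rw [← hv n]
    exact H01.mem_graph D (v n)
  let z : H01 D := ⟨w, (w, g), hmem, rfl⟩
  exact ⟨z, (H01.existsUnique_grad D z).unique (H01.mem_graph D z) hmem⟩

instance (D : BoundedDomain d) : CompleteSpace (H01 D) :=
  IsUniformInducing.completeSpace (f := H01.grad D) ⟨rfl⟩ (isClosed_range_grad D).isComplete

variable {m m' : EuclideanSpace ℝ (Fin d) → ℝ}

theorem exists_ae_abs_le (hm : MemLp m ∞ D.measure) :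
    ∃ C : ℝ, ∀ᵐ x ∂D.measure, ‖m x‖ ≤ C := by
  have hfin : eLpNormEssSup m D.measure ≠ ∞ := by
    rw [← eLpNorm_exponent_top]
    exact hm.2.ne
  refine ⟨(eLpNormEssSup m D.measure).toReal, ?_⟩
  filter_upwards [enorm_ae_le_eLpNormEssSup m D.measure] with x hx
  rw [← toReal_enorm]
  exact ENNReal.toReal_mono hfin hx

theorem integrable_mul_inner_grad (hm : MemLp m ∞ D.measure) (w v : H01 D) :
    Integrable (fun x => m x * ⟪H01.grad D w x, H01.grad D v x⟫) D.measure := by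
  obtain ⟨C, hC⟩ := exists_ae_abs_le hm
  exact (L2.integrable_inner (𝕜 := ℝ) (H01.grad D w) (H01.grad D v)).bdd_mul hm.1 hC

/-- Every bounded coefficient `m` defines an operator `T` on `H₀¹(D)` by
`⟪T w, v⟫ = ∫ m ∇w·∇v`. -/
theorem exists_operator (hm : MemLp m ∞ D.measure) :
    ∃ T : H01 D →L[ℝ] H01 D, ∀ w v,
      ⟪T w, v⟫ = ∫ x, m x * ⟪H01.grad D w x, H01.grad D v x⟫ ∂D.measure := by
  obtain ⟨C, hC⟩ := exists_ae_abs_le hm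
  have hmul : ∀ g : L2Vec D, MemLp (m • (g : EuclideanSpace ℝ (Fin d) → _)) 2 D.measure :=
    fun g => (Lp.memLp g).smul hm
  let M : L2Vec D →ₗ[ℝ] L2Vec D :=
    { toFun := fun g => (hmul g).toLp _
      map_add' := fun g h => by
        apply Lp.ext
        filter_upwards [(hmul (g + h)).coeFn_toLp, (hmul g).coeFn_toLp, (hmul h).coeFn_toLp,
          Lp.coeFn_add ((hmul g).toLp _) ((hmul h).toLp _), Lp.coeFn_add g h]
          with x h1 h2 h3 h4 h5
        rw [h1, h4, Pi.add_apply, h2, h3]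
        rw [Pi.smul_apply', h5, Pi.add_apply, smul_add]
        rfl
      map_smul' := fun c g => by
        apply Lp.ext
        filter_upwards [(hmul (c • g)).coeFn_toLp, (hmul g).coeFn_toLp,
          Lp.coeFn_smul c ((hmul g).toLp _), Lp.coeFn_smul c g] with x h1 h2 h4 h5
        rw [h1, RingHom.id_apply, h4, Pi.smul_apply, h2]
        rw [Pi.smul_apply', h5, Pi.smul_apply, smul_comm]
        rfl }
  let ML : L2Vec D →L[ℝ] L2Vec D := M.mkContinuous C fun g => by
    apply Lp.norm_le_mul_norm_of_ae_le_mul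
    filter_upwards [(hmul g).coeFn_toLp, hC] with x h1 h2
    simp only [M, LinearMap.coe_mk, AddHom.coe_mk]
    rw [h1, Pi.smul_apply', norm_smul]
    gcongr
  -- The operator is `∇* ∘ (multiplication by m) ∘ ∇`.
  refine ⟨(ContinuousLinearMap.adjoint (gradL D)).comp (ML.comp (gradL D)), fun w v => ?_⟩
  rw [ContinuousLinearMap.comp_apply, ContinuousLinearMap.adjoint_inner_left, L2.inner_def]
  apply integral_congr_ae
  filter_upwards [(hmul (H01.grad D w)).coeFn_toLp] with x h1
  change ⟪(hmul (H01.grad D w)).toLp _ x, H01.grad D v x⟫ = _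
  rw [h1, Pi.smul_apply', real_inner_smul_left]

/-- The weighted Dirichlet energy `∫ m |∇w|²`. -/
noncomputable def energy (D : BoundedDomain d) (m : EuclideanSpace ℝ (Fin d) → ℝ)
    (w : H01 D) : ℝ :=
  ∫ x, m x * ⟪H01.grad D w x, H01.grad D w x⟫ ∂D.measure

theorem energy_mono (hm : MemLp m ∞ D.measure) (hm' : MemLp m' ∞ D.measure)
    (h : ∀ᵐ x ∂D.measure, m x ≤ m' x) (w : H01 D) : energy D m w ≤ energy D m' w := by
  refine integral_mono_ae (integrable_mul_inner_grad hm w w) (integrable_mul_inner_grad hm' w w) ?_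
  filter_upwards [h] with x hx
  exact mul_le_mul_of_nonneg_right hx real_inner_self_nonneg

theorem energy_nonneg (h : ∀ x, 0 ≤ m x) (w : H01 D) : 0 ≤ energy D m w :=
  integral_nonneg fun x => mul_nonneg (h x) real_inner_self_nonneg

theorem energy_const_mul (c : ℝ) (w : H01 D) :
    energy D (fun x => c * m x) w = c * energy D m w := by
  simp only [energy, mul_assoc, integral_const_mul]

theorem energy_const (c : ℝ) (w : H01 D) : energy D (fun _ => c) w = c * ‖w‖ ^ 2 := by
  rw [energy, integral_const_mul, H01.norm_def, ← real_inner_self_eq_norm_sq, L2.inner_def]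

theorem sum_energy {ι : Type*} (s : Finset ι) {μ : ι → EuclideanSpace ℝ (Fin d) → ℝ}
    (h : ∀ j ∈ s, MemLp (μ j) ∞ D.measure) (w : H01 D) :
    ∑ j ∈ s, energy D (μ j) w = energy D (fun x => ∑ j ∈ s, μ j x) w := by
  simp only [energy, Finset.sum_mul]
  exact (integral_finsetSum s fun j hj => integrable_mul_inner_grad (h j hj) w w).symm

/-- The gap dominates `|c| (r‖q‖ - ‖p‖)² / (2r)`. Keeping `|c|` as a pointwise weight lets the later
sum over `j` be taken under the integral, so that the sup norm of a sum appears and not a sum of sup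
norms. -/
theorem neg_mul_inner_le_young {V : Type*} [NormedAddCommGroup V] [InnerProductSpace ℝ V]
    (c : ℝ) (p q : V) {r : ℝ} (hr : 0 < r) :
    -(c * ⟪p, q⟫) ≤ r / 2 * (|c| * ⟪q, q⟫) + 1 / (2 * r) * (|c| * ⟪p, p⟫) := by
  have h1 : -(c * ⟪p, q⟫) ≤ |c| * (‖p‖ * ‖q‖) := by
    calc -(c * ⟪p, q⟫) ≤ |c * ⟪p, q⟫| := neg_le_abs _
      _ = |c| * |⟪p, q⟫| := abs_mul _ _
      _ ≤ _ := by gcongr; exact abs_real_inner_le_norm p q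
  refine h1.trans ?_
  rw [real_inner_self_eq_norm_sq, real_inner_self_eq_norm_sq]
  have h2 : r / 2 * (|c| * ‖q‖ ^ 2) + 1 / (2 * r) * (|c| * ‖p‖ ^ 2) - |c| * (‖p‖ * ‖q‖) =
      |c| * (r * ‖q‖ - ‖p‖) ^ 2 / (2 * r) := by
    field_simp
    ring
  have : 0 ≤ |c| * (r * ‖q‖ - ‖p‖) ^ 2 / (2 * r) := by positivity
  linarith

theorem neg_integral_le_young (hm : MemLp m ∞ D.measure) (w v : H01 D) {r : ℝ} (hr : 0 < r) :
    -∫ x, m x * ⟪H01.grad D w x, H01.grad D v x⟫ ∂D.measure ≤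
      r / 2 * energy D (fun x => |m x|) v + 1 / (2 * r) * energy D (fun x => |m x|) w := by
  have hm' : MemLp (fun x => |m x|) ∞ D.measure := hm.abs
  rw [energy, energy, ← integral_neg, ← integral_const_mul, ← integral_const_mul, ← integral_add]
  · exact integral_mono (integrable_mul_inner_grad hm w v).neg
      (((integrable_mul_inner_grad hm' v v).const_mul _).add
        ((integrable_mul_inner_grad hm' w w).const_mul _))
      fun x => neg_mul_inner_le_young _ _ _ hr
  · exact (integrable_mul_inner_grad hm' v v).const_mul _
  · exact (integrable_mul_inner_grad hm' w w).const_mul _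

end Operators

/-! ### The affine coefficient -/

section Coefficient

variable {d : ℕ} {D : BoundedDomain d} {a₀ : EuclideanSpace ℝ (Fin d) → ℝ}
  {ψ : ℕ → EuclideanSpace ℝ (Fin d) → ℝ}

/-- One null set serves all finite `s`. As `kappa` sums in `ℝ≥0∞`, real summability is not
presupposed; the uniform bound on partial sums provides it. -/
theorem ae_sum_le_of_kappa_le (ha : ∀ᵐ x ∂D.measure, 0 < a₀ x) {b : ℕ → ℝ} (hb : ∀ j, 0 < b j)
    {C : ℝ} (hC : 0 ≤ C) (h : kappa D a₀ ψ b ≤ ENNReal.ofReal C) :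
    ∀ᵐ x ∂D.measure, ∀ s : Finset ℕ, ∑ j ∈ s, |ψ j x| / b j / (2 * a₀ x) ≤ C := by
  rw [kappa, eLpNorm_exponent_top] at h
  filter_upwards [ha, enorm_ae_le_eLpNormEssSup
    (fun x => ∑' j, ENNReal.ofReal (|ψ j x| / b j / (2 * a₀ x))) D.measure] with x hx h1 s
  rw [← ENNReal.ofReal_le_ofReal_iff hC, ENNReal.ofReal_sum_of_nonneg]
  · rw [enorm_eq_self] at h1
    exact (ENNReal.sum_le_tsum s).trans (h1.trans h)
  · intro j _
    have := hb j
    positivity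

theorem ae_summable_and_tsum_le (ha : ∀ᵐ x ∂D.measure, 0 < a₀ x) {C : ℝ} (hC : 0 ≤ C)
    (h : kappa D a₀ ψ (fun _ => 1) ≤ ENNReal.ofReal C) :
    ∀ᵐ x ∂D.measure, Summable (fun j => |ψ j x|) ∧ ∑' j, |ψ j x| ≤ 2 * C * a₀ x := by
  filter_upwards [ha, ae_sum_le_of_kappa_le ha (fun _ => one_pos) hC h] with x hx h1
  have h2 : ∀ s : Finset ℕ, ∑ j ∈ s, |ψ j x| ≤ 2 * C * a₀ x := by
    intro s
    have := h1 s
    simp only [div_one] at this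
    rw [← Finset.sum_div, div_le_iff₀ (by positivity)] at this
    linarith
  have h3 := summable_of_sum_le (fun j => abs_nonneg (ψ j x)) h2
  exact ⟨h3, h3.tsum_le_of_sum_le h2⟩

theorem abs_mul_le_of_mem_paramDomain {y : ℕ → ℝ} (hy : y ∈ paramDomain) (j : ℕ) (z : ℝ) :
    |y j * z| ≤ 1 / 2 * |z| := by
  rw [abs_mul]
  have := hy j (mem_univ j)
  gcongr
  exact abs_le.2 ⟨by linarith [this.1], this.2⟩

theorem summable_param_mul {y : ℕ → ℝ} (hy : y ∈ paramDomain)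
    {x : EuclideanSpace ℝ (Fin d)} (h : Summable fun j => |ψ j x|) :
    Summable fun j => y j * ψ j x :=
  Summable.of_norm_bounded (h.mul_left (1 / 2)) fun j => abs_mul_le_of_mem_paramDomain hy j _

theorem abs_coeff_sub_le {y : ℕ → ℝ} (hy : y ∈ paramDomain) {x : EuclideanSpace ℝ (Fin d)}
    (h : Summable fun j => |ψ j x|) {C : ℝ} (hC : ∑' j, |ψ j x| ≤ 2 * C * a₀ x) :
    |coeff a₀ ψ y x - a₀ x| ≤ C * a₀ x := by
  rw [coeff, add_sub_cancel_left]
  calc |∑' j, y j * ψ j x| ≤ 1 / 2 * ∑' j, |ψ j x| := by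
        rw [← Real.norm_eq_abs]
        exact tsum_of_norm_bounded (h.hasSum.mul_left (1 / 2))
          fun j => abs_mul_le_of_mem_paramDomain hy j _
    _ ≤ C * a₀ x := by linarith

theorem coeff_update {y : ℕ → ℝ} (hy : y ∈ paramDomain) {x : EuclideanSpace ℝ (Fin d)}
    (h : Summable fun j => |ψ j x|) (i : ℕ) (t : ℝ) :
    coeff a₀ ψ (Function.update y i t) x = coeff a₀ ψ y x + (t - y i) * ψ i x := by
  have e : (fun j => Function.update y i t j * ψ j x) =
      fun j => y j * ψ j x + if j = i then (t - y i) * ψ i x else 0 := by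
    ext j
    rcases eq_or_ne j i with rfl | hj
    · simp
      ring
    · simp [hj]
  rw [coeff, coeff, e, (summable_param_mul hy h).tsum_add ((hasSum_ite_eq i _).summable),
    tsum_ite_eq, add_assoc]

theorem memLp_coeff (ha₀ : MemLp a₀ ∞ D.measure) (hψ : ∀ j, MemLp (ψ j) ∞ D.measure)
    {C : ℝ} (hC : 0 ≤ C)
    (hsum : ∀ᵐ x ∂D.measure, Summable (fun j => |ψ j x|) ∧ ∑' j, |ψ j x| ≤ 2 * C * a₀ x)
    {y : ℕ → ℝ} (hy : y ∈ paramDomain) : MemLp (coeff a₀ ψ y) ∞ D.measure := by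
  obtain ⟨K, hK⟩ := exists_ae_abs_le ha₀
  have hmeas : AEMeasurable (coeff a₀ ψ y) D.measure :=
    ha₀.1.aemeasurable.add (AEMeasurable.tsum fun j => (hψ j).1.aemeasurable.const_mul (y j))
  refine memLp_top_of_bound hmeas.aestronglyMeasurable (C * K + K) ?_
  filter_upwards [hK, hsum] with x h1 h2
  have h3 := abs_coeff_sub_le (a₀ := a₀) hy h2.1 h2.2
  have h4 := abs_add_le (coeff a₀ ψ y x - a₀ x) (a₀ x)
  rw [sub_add_cancel] at h4
  rw [Real.norm_eq_abs] at h1 ⊢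
  have h5 : C * a₀ x ≤ C * K := mul_le_mul_of_nonneg_left ((le_abs_self _).trans h1) hC
  linarith

theorem kappaTilde_nonneg (b : ℕ → ℝ) (ν : ℕ →₀ ℕ) : 0 ≤ kappaTilde D a₀ ψ b ν :=
  ENNReal.toReal_nonneg

theorem ae_sum_le_kappaTilde (ha : ∀ᵐ x ∂D.measure, 0 < a₀ x) {b : ℕ → ℝ} (hb : ∀ j, 0 < b j)
    (h : kappa D a₀ ψ b < 1) (ν : ℕ →₀ ℕ) :
    ∀ᵐ x ∂D.measure,
      ∑ j ∈ ν.support, |ψ j x| / b j ≤ 2 * kappaTilde D a₀ ψ b ν * a₀ x := by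
  have hle := ae_sum_le_of_kappa_le ha hb zero_le_one (h.le.trans (by simp))
  -- `kappaTilde` is a `toReal`, which would be `0` for an infinite norm; `κ < 1` excludes this.
  have hfin : eLpNormEssSup (fun x => ∑ j ∈ ν.support, |ψ j x| / b j / (2 * a₀ x)) D.measure
      ≠ ∞ := by
    refine ((eLpNormEssSup_le_of_ae_bound (C := 1) ?_).trans_lt ENNReal.ofReal_lt_top).ne
    filter_upwards [ha, hle] with x hx h1
    rw [Real.norm_of_nonneg]
    · exact h1 _
    · refine Finset.sum_nonneg fun j _ => ?_
      have := hb j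
      positivity
  filter_upwards [ha, enorm_ae_le_eLpNormEssSup
    (fun x => ∑ j ∈ ν.support, |ψ j x| / b j / (2 * a₀ x)) D.measure] with x hx h1
  have h2 := ENNReal.toReal_mono hfin h1
  rw [toReal_enorm] at h2
  have h3 := (le_abs_self _).trans h2
  rw [← eLpNorm_exponent_top, ← kappaTilde, ← Finset.sum_div, div_le_iff₀ (by positivity)] at h3
  linarith

end Coefficient

/-! ### Multi-indices with entries in `{0, 1}` -/

section MultiIndex

theorem degree_eq_card_support {ω : ℕ →₀ ℕ} (hω : ∀ j, ω j ≤ 1) :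
    ω.degree = ω.support.card := by
  rw [Finsupp.degree_apply, Finset.card_eq_sum_ones]
  refine Finset.sum_congr rfl fun j hj => ?_
  have := hω j
  have : ω j ≠ 0 := by simpa using hj
  omega

theorem monom_eq_prod_support (b : ℕ → ℝ) {ω : ℕ →₀ ℕ} (hω : ∀ j, ω j ≤ 1) :
    monom b ω = ∏ j ∈ ω.support, b j := by
  rw [monom, Finsupp.prod]
  refine Finset.prod_congr rfl fun j hj => ?_
  have := hω j
  have : ω j ≠ 0 := by simpa using hj
  rw [show ω j = 1 by omega, pow_one]

/-- Multi-indices below `ν` have entries in `{0, 1}`, so they are indicators of subsets of the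
support of `ν`. -/
theorem sum_Iic_degree_eq_sum_powersetCard {M : Type*} [AddCommMonoid M] {ν : ℕ →₀ ℕ}
    (hν : ∀ j, ν j ≤ 1) (k : ℕ) (g : Finset ℕ → M) :
    ∑ ω ∈ Finset.Iic ν with ω.degree = k, g ω.support =
      ∑ s ∈ ν.support.powersetCard k, g s := by
  refine Finset.sum_bij' (fun ω _ => ω.support) (fun s _ => Finsupp.indicator s fun _ _ => 1)
    ?_ ?_ ?_ ?_ (fun _ _ => rfl)
  · intro ω h
    simp only [Finset.mem_filter, Finset.mem_Iic] at h
    rw [Finset.mem_powersetCard, ← degree_eq_card_support fun j => (h.1 j).trans (hν j)]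
    exact ⟨Finsupp.support_mono h.1, h.2⟩
  · intro s h
    rw [Finset.mem_powersetCard] at h
    have hle : Finsupp.indicator s (fun _ _ => 1) ≤ ν := by
      intro j
      rw [Finsupp.indicator_apply]
      split_ifs with hj
      · exact Nat.one_le_iff_ne_zero.2 (by simpa using h.1 hj)
      · exact Nat.zero_le _
    simp only [Finset.mem_filter, Finset.mem_Iic]
    refine ⟨hle, ?_⟩
    rw [degree_eq_card_support fun j => (hle j).trans (hν j), ← h.2]
    congr 1
    ext j
    simp [Finsupp.indicator_apply]
  · intro ω h
    simp only [Finset.mem_filter, Finset.mem_Iic] at h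
    ext j
    rw [Finsupp.indicator_apply]
    have := (h.1 j).trans (hν j)
    split_ifs with hj
    · have : ω j ≠ 0 := by simpa using hj
      omega
    · have : ω j = 0 := by simpa using hj
      omega
  · intro s _
    ext j
    simp [Finsupp.indicator_apply]

end MultiIndex

end ParametricDiffusion

namespace ParametricDiffusion

/-! ### The weighted estimate for all sensitivities of a given order -/

section Estimate

variable {E : Type*} [NormedAddCommGroup E] [InnerProductSpace ℝ E]
  {A : (ℕ → ℝ) → E →L[ℝ] E} {P : ℕ → E →L[ℝ] E} {F : E} {b : ℕ → ℝ} {N : Finset ℕ} {e : E → ℝ}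
  {q : ℕ → E → ℝ} {c θ α : ℝ}

theorem sum_norm_sensitivity_sq_le {y : ℕ → ℝ} (hA : IsUnit (A y))
    (hc : 0 < c) (hθ : 0 ≤ θ) (hα : 0 < α) (he : ∀ w, α * ‖w‖ ^ 2 ≤ e w)
    (hcoer : ∀ w, c * e w ≤ ⟪A y w, w⟫) (hq0 : ∀ j w, 0 ≤ q j w)
    (hq : ∀ w, ∑ j ∈ N, q j w ≤ θ * e w)
    (hP : ∀ j w v, ∀ r > 0, -⟪(b j)⁻¹ • P j w, v⟫ ≤ r / 2 * q j v + 1 / (2 * r) * q j w)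
    (k : ℕ) :
    ∑ s ∈ N.powersetCard k, ((∏ j ∈ s, b j) ^ 2)⁻¹ * ‖sensitivity A P F s y‖ ^ 2 ≤
      ((θ / c) ^ k * (‖F‖ / (c * α))) ^ 2 := by
  -- This rescaling moves the weights into the operators: `X` satisfies the same recursion with
  -- `b_j⁻¹ P_j` in place of `P_j`.
  let X : Finset ℕ → E := fun s => (∏ j ∈ s, b j)⁻¹ • sensitivity A P F s y
  have hX : ∀ s, s.Nonempty → A y (X s) = -∑ j ∈ s, ((b j)⁻¹ • P j) (X (s.erase j)) := by
    intro s hs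
    simp only [X, map_smul]
    rw [apply_sensitivity hA, if_neg hs.ne_empty, zero_sub, smul_neg, Finset.smul_sum]
    congr 1
    refine Finset.sum_congr rfl fun j hj => ?_
    rw [smul_apply, smul_smul, ← Finset.mul_prod_erase s b hj, mul_inv, mul_comm]
  have hX0 : A y (X ∅) = F := by
    simp only [X, map_smul]
    rw [apply_sensitivity hA]
    simp
  have hsum := sum_energy_le (A := A y) (Q := fun j => (b j)⁻¹ • P j) (X := X) (N := N) hc hθ hX
    hcoer hq0 hq (fun j w v r hr => hP j w v r hr) k
  have h0 := energy_solution_le hc hα (hcoer (X ∅)) (he (X ∅)) hX0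
  have hnorm : ∀ s, ((∏ j ∈ s, b j) ^ 2)⁻¹ * ‖sensitivity A P F s y‖ ^ 2 = ‖X s‖ ^ 2 := by
    intro s
    rw [norm_smul, mul_pow, norm_inv, inv_pow, Real.norm_eq_abs, sq_abs]
  simp_rw [hnorm]
  have h1 : α * ∑ s ∈ N.powersetCard k, ‖X s‖ ^ 2 ≤
      α * ((θ / c) ^ k * (‖F‖ / (c * α))) ^ 2 := by
    calc α * ∑ s ∈ N.powersetCard k, ‖X s‖ ^ 2 ≤ ∑ s ∈ N.powersetCard k, e (X s) := by
          rw [Finset.mul_sum]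
          exact Finset.sum_le_sum fun s _ => he (X s)
      _ ≤ ((θ / c) ^ k) ^ 2 * (‖F‖ ^ 2 / (c ^ 2 * α)) := hsum.trans (by gcongr)
      _ = α * ((θ / c) ^ k * (‖F‖ / (c * α))) ^ 2 := by
          rw [mul_pow _ (‖F‖ / (c * α)), div_pow ‖F‖]
          field_simp
  exact le_of_mul_le_mul_left h1 hα

end Estimate

end ParametricDiffusion

/-! ### The parametric diffusion problem -/

theorem theorem1 {d : ℕ} (D : BoundedDomain d)
    (a₀ : EuclideanSpace ℝ (Fin d) → ℝ) (ψ : ℕ → EuclideanSpace ℝ (Fin d) → ℝ)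
    (ha₀ : MemLp a₀ ∞ D.measure) (hψ : ∀ j, MemLp (ψ j) ∞ D.measure)
    (a₀min a₀max : ℝ) (hmin : 0 < a₀min)
    (hbounds : ∀ᵐ x ∂D.measure, a₀min ≤ a₀ x ∧ a₀ x ≤ a₀max)
    (κbar : ℝ) (hκbar_pos : 0 < κbar) (hκbar_lt : κbar < 1)
    (hκbar : kappa D a₀ ψ (fun _ => 1) ≤ ENNReal.ofReal κbar)
    (b : ℕ → ℝ) (hb : ∀ j, 0 < b j ∧ b j ≤ 1) (hκ : kappa D a₀ ψ b < 1)
    (f : StrongDual ℝ (H01 D)) :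
    -- the weak problem is uniquely solvable for every parameter
    (∀ y ∈ paramDomain, ∃! w : H01 D, IsWeakSolution D a₀ ψ f y w) ∧
    ∀ u : (ℕ → ℝ) → H01 D, (∀ y ∈ paramDomain, IsWeakSolution D a₀ ψ f y (u y)) →
      ∀ ν : ℕ →₀ ℕ, (∀ j, ν j ≤ 1) →
        -- the derivatives `∂^ω u`, `ω ≤ ν`, exist in `V` on all of `U`
        (∀ (ω : ℕ →₀ ℕ) (j : ℕ), ω + Finsupp.single j 1 ≤ ν → ∀ y ∈ paramDomain,
          HasDerivWithinAt (fun t => mixedDeriv ω u (Function.update y j t))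
            (mixedDeriv (ω + Finsupp.single j 1) u y) (Icc (-1 / 2) (1 / 2)) (y j)) ∧
        (∀ k ≤ ν.degree, ∀ y ∈ paramDomain,
          ∑ ω ∈ Finset.Iic ν with ω.degree = k,
              (monom b ω ^ 2)⁻¹ * ‖mixedDeriv ω u y‖ ^ 2 ≤
            ((2 * kappaTilde D a₀ ψ b ν / (1 - κbar)) ^ k *
              (‖f‖ / ((1 - κbar) * a₀min))) ^ 2) ∧
        (∀ y ∈ paramDomain,
          ‖mixedDeriv ν u y‖ ≤
            monom b ν * (2 * kappaTilde D a₀ ψ b ν / (1 - κbar)) ^ ν.degree *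
              (‖f‖ / ((1 - κbar) * a₀min))) := by
  classical
  have ha : ∀ᵐ x ∂D.measure, 0 < a₀ x := by
    filter_upwards [hbounds] with x hx using hmin.trans_le hx.1
  have hsum := ae_summable_and_tsum_le ha hκbar_pos.le hκbar
  have hcpos : 0 < 1 - κbar := sub_pos.2 hκbar_lt
  have hbpos : ∀ j, 0 < b j := fun j => (hb j).1
  have hcoeff : ∀ y ∈ paramDomain, MemLp (coeff a₀ ψ y) ∞ D.measure := fun y hy =>
    memLp_coeff ha₀ hψ hκbar_pos.le hsum hy
  choose P hP using fun j => exists_operator (hψ j)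
  -- Outside `paramDomain` the coefficient need not be bounded, so `A y` is specified only on it.
  have hex : ∀ y, ∃ T : H01 D →L[ℝ] H01 D, y ∈ paramDomain →
      ∀ w v, ⟪T w, v⟫ = bilinForm D a₀ ψ y w v := by
    intro y
    by_cases hy : y ∈ paramDomain
    · obtain ⟨T, hT⟩ := exists_operator (hcoeff y hy)
      exact ⟨T, fun _ => hT⟩
    · exact ⟨0, fun h => absurd h hy⟩
  choose A hA using hex
  have henergy : ∀ w, a₀min * ‖w‖ ^ 2 ≤ energy D a₀ w := by
    intro w
    rw [← energy_const]
    refine energy_mono (memLp_top_const _) ha₀ ?_ w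
    filter_upwards [hbounds] with x hx using hx.1
  have hcoer : ∀ y ∈ paramDomain, ∀ w, (1 - κbar) * energy D a₀ w ≤ ⟪A y w, w⟫ := by
    intro y hy w
    rw [hA y hy, ← energy_const_mul]
    refine energy_mono (ha₀.const_mul _) (hcoeff y hy) ?_ w
    filter_upwards [hsum] with x hx
    have := (abs_le.1 (abs_coeff_sub_le (a₀ := a₀) hy hx.1 hx.2)).1
    linarith
  have hunit : ∀ y ∈ paramDomain, IsUnit (A y) := fun y hy =>
    isUnit_of_coercive (C := (1 - κbar) * a₀min) (by positivity) fun w => by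
      refine le_trans ?_ (hcoer y hy w)
      rw [mul_assoc]
      exact mul_le_mul_of_nonneg_left (henergy w) hcpos.le
  have hstep : ∀ y ∈ paramDomain, ∀ i, ∀ t ∈ Icc (-1 / 2 : ℝ) (1 / 2),
      A (Function.update y i t) = A y + (t - y i) • P i := by
    intro y hy i t ht
    ext1 w
    refine ext_inner_right ℝ fun v => ?_
    rw [hA _ (update_mem_paramDomain hy i ht), add_apply, smul_apply, inner_add_left,
      real_inner_smul_left, hA y hy, hP, bilinForm, bilinForm, ← integral_const_mul,
      ← integral_add (integrable_mul_inner_grad (hcoeff y hy) w v)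
        ((integrable_mul_inner_grad (hψ i) w v).const_mul _)]
    apply integral_congr_ae
    filter_upwards [hsum] with x hx
    rw [coeff_update hy hx.1]
    ring
  set F : H01 D := (InnerProductSpace.toDual ℝ (H01 D)).symm f with hF
  have hFnorm : ‖F‖ = ‖f‖ := LinearIsometryEquiv.norm_map _ _
  have hweak : ∀ y ∈ paramDomain, ∀ w, IsWeakSolution D a₀ ψ f y w ↔ A y w = F := by
    intro y hy w
    constructor
    · intro h
      refine ext_inner_right ℝ fun v => ?_
      rw [hA y hy, h v, hF, InnerProductSpace.toDual_symm_apply]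
    · intro h v
      rw [← hA y hy, h, hF, InnerProductSpace.toDual_symm_apply]
  refine ⟨fun y hy => ?_, fun u hu ν hν => ?_⟩
  · simp_rw [hweak y hy]
    exact (ContinuousLinearMap.isUnit_iff_bijective.1 (hunit y hy)).existsUnique F
  have hAu : ∀ y ∈ paramDomain, A y (u y) = F := fun y hy => (hweak y hy _).1 (hu y hy)
  have hmixed : ∀ ω : ℕ →₀ ℕ, (∀ j, ω j ≤ 1) → ∀ y ∈ paramDomain,
      mixedDeriv ω u y = sensitivity A P F ω.support y := fun ω hω y hy =>
    mixedDeriv_eq_sensitivity hunit hstep hAu hω hy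
  have hest : ∀ k, ∀ y ∈ paramDomain, ∑ ω ∈ Finset.Iic ν with ω.degree = k,
      (monom b ω ^ 2)⁻¹ * ‖mixedDeriv ω u y‖ ^ 2 ≤
        ((2 * kappaTilde D a₀ ψ b ν / (1 - κbar)) ^ k * (‖f‖ / ((1 - κbar) * a₀min))) ^ 2 := by
    intro k y hy
    have hq : ∀ j, MemLp (fun x => |(b j)⁻¹ * ψ j x|) ∞ D.measure := fun j =>
      ((hψ j).const_mul _).abs
    rw [← hFnorm]
    -- The constants are `c = 1 - κbar`, `θ = 2 κ̃(ν)`, `α = a₀min`, with energy weight `a₀` and `q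
    -- j` weighted by `|ψ j| / b j`.
    refine Eq.trans_le ?_ (sum_norm_sensitivity_sq_le (P := P) (b := b) (N := ν.support)
      (q := fun j => energy D fun x => |(b j)⁻¹ * ψ j x|) (hunit y hy) hcpos
      (mul_nonneg zero_le_two (kappaTilde_nonneg b ν)) hmin henergy (hcoer y hy)
      (fun j w => energy_nonneg (fun x => abs_nonneg _) w) ?_ ?_ k)
    · rw [← sum_Iic_degree_eq_sum_powersetCard hν k fun s =>
        ((∏ j ∈ s, b j) ^ 2)⁻¹ * ‖sensitivity A P F s y‖ ^ 2]
      refine Finset.sum_congr rfl fun ω hω => ?_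
      have hω1 : ∀ j, ω j ≤ 1 := fun j =>
        (Finset.mem_Iic.1 (Finset.mem_filter.1 hω).1 j).trans (hν j)
      rw [monom_eq_prod_support b hω1, hmixed ω hω1 y hy]
    · intro w
      rw [sum_energy _ fun j _ => hq j, ← energy_const_mul]
      refine energy_mono (memLp_finsetSum _ fun j _ => hq j) (ha₀.const_mul _) ?_ w
      filter_upwards [ae_sum_le_kappaTilde ha hbpos hκ ν] with x hx
      refine (Finset.sum_congr rfl fun j _ => ?_).trans_le hx
      rw [abs_mul, abs_of_pos (inv_pos.2 (hbpos j)), inv_mul_eq_div]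
    · intro j w v r hr
      have := neg_integral_le_young ((hψ j).const_mul (b j)⁻¹) w v hr
      rw [real_inner_smul_left, hP, ← integral_const_mul]
      simpa only [mul_assoc] using this
  refine ⟨fun ω j hωj y hy => ?_, fun k _ y hy => hest k y hy, fun y hy => ?_⟩
  · have h1 : ∀ i, (ω + Finsupp.single j 1 : ℕ →₀ ℕ) i ≤ 1 := fun i => (hωj i).trans (hν i)
    have hω1 : ∀ i, ω i ≤ 1 := fun i => (by simp : ω i ≤ (ω + Finsupp.single j 1 : ℕ →₀ ℕ) i).trans (h1 i)
    have hj : j ∉ ω.support := by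
      have := h1 j
      simp at this
      simpa using this
    have hsupp : (ω + Finsupp.single j 1).support = insert j ω.support := by
      ext i
      rcases eq_or_ne i j with rfl | hij
      · simp
      · simp [hij]
    rw [hmixed _ h1 y hy, hsupp]
    refine (hasDerivWithinAt_sensitivity (F := F) hunit hstep j ω.support hj hy).congr
      (fun t ht => hmixed ω hω1 _ (update_mem_paramDomain hy j ht)) ?_
    exact hmixed ω hω1 _ (update_mem_paramDomain hy j (hy j (mem_univ j)))
  · have hmon : 0 < monom b ν := by
      rw [monom_eq_prod_support b hν]
      exact Finset.prod_pos fun j _ => hbpos j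
    have hmem : ν ∈ (Finset.Iic ν).filter fun ω => ω.degree = ν.degree :=
      Finset.mem_filter.2 ⟨Finset.mem_Iic.2 le_rfl, rfl⟩
    -- The term of `ν` is bounded by the whole sum of order `|ν|`, since all terms are nonnegative;
    -- square roots then give the claim.
    have h1 : (monom b ν ^ 2)⁻¹ * ‖mixedDeriv ν u y‖ ^ 2 ≤ _ :=
      (Finset.single_le_sum (f := fun ω => (monom b ω ^ 2)⁻¹ * ‖mixedDeriv ω u y‖ ^ 2)
        (fun ω _ => by positivity) hmem).trans
        (hest ν.degree y hy)
    rw [← inv_pow, ← mul_pow] at h1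
    have hκt := kappaTilde_nonneg (D := D) (a₀ := a₀) (ψ := ψ) b ν
    have h2 := (sq_le_sq₀ (by positivity) (by positivity)).1 h1
    rw [inv_mul_le_iff₀ hmon, ← mul_assoc] at h2
    exact h2
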